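/- Let $c:[0,\infty)\to\mathbb R$ be Lebesgue measurable and integrable on every $[0,t]$, and let $\tau:[0,\infty)\to\mathbb R$ be Lebesgue measurable with $\tau(t)\le t$ for all $t\ge 0$ and $\tau(t)\to\infty$ as $t\to\infty$. Put $\tau_{\min}(t)=\inf_{v\ge t}\tau(v)$ and $\tau_{\min}^2(t)=\tau_{\min}(\tau_{\min}(t))$. Fix $a\ge 0$ with $\tau_{\min}(a)>0$ and $\rho>\inf\{t>0:\tau_{\min}(t)>a\}$. Consider the equation $$x'(t)+c(t)\,x(\tau(t))=0. \tag{1}$$ For $t_0\ge\rho$, a solution of (1) with initial time $t_0$ is a function $x:[\tau_{\min}(t_0),\infty)\to\mathbb R$ that is absolutely continuous on compact subintervals and satisfies (1) for almost every $t\ge t_0$. For $\ell\ge 0$, it is called $\ell$-rapidly oscillating if it has arbitrarily large zeros and there is $t_1\ge t_0$ such that $$\int_A^B|c(v)|\,dv\le \ell\quad\text{whenever } t_1\le A<B \text{ and } x(v)\ne 0 \text{ for all } v\in(A,B). \tag{2}$$ For $s\in[1,2]$ let $\Lambda(s)=2+s-\sqrt{2s}-\ln(\sqrt{2s}-1)$.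 **Theorem.** Let $\ell\ge 0$ and assume that at least one of the following holds: (a) $\ell<2$; (b) for some $s\in[1,2]$, $\ \sup_{t\ge\rho}\int_{\tau(t)}^t|c(v)|\,dv\le s$ and $\ell<\Lambda(s)$. Assume also that there are $C,D>0$ and $T\ge\rho$ such that for all $t\ge T$ $$|t-\tau_{\min}^2(t)|\le C\quad\text{and}\quad \int_{\tau_{\min}^2(t)}^t|c(v)|\,dv\ge D .$$ Then every $\ell$-rapidly oscillating solution of (1) tends to zero exponentially. More precisely, there are constants $M,\gamma,\delta>0$ such that, for every $t_0\ge\rho$, every $\ell$-rapidly oscillating solution $x$ of (1) with initial time $t_0$, and every $t_1\ge\max(t_0,T)$ for which (2) holds (all sufficiently large $t_1$ have this property), $$|x(t)|\le M\,\sup_{u\in[t_1,t_1+\delta]}|x(u)|\;e^{-\gamma(t-t_1)}\qquad\text{for all } t\ge t_1 .$$ -/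

import Mathlib

open MeasureTheory Set Filter Topology

noncomputable section

/-- `tauMin τ t = inf_{v ≥ t} τ v`. It is used only at points `t` where `τ` is bounded below
on `[t, ∞)`; elsewhere `sInf` returns `0`, which satisfies none of the strict lower bounds
`0 < tauMin τ a` and `a < tauMin τ t` (with `0 ≤ a`) that are imposed below. -/
def tauMin (τ : ℝ → ℝ) (t : ℝ) : ℝ := sInf (τ '' Ici t)

/-- The standing assumptions on the coefficient `c` and on the argument `τ` of the equation
`x'(t) + c(t) x(τ(t)) = 0`; only the values of `c` and `τ` on `[0, ∞)` matter. -/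
structure IsDelayData (c τ : ℝ → ℝ) : Prop where
  /-- `c` is Lebesgue measurable and integrable on every `[0, t]`. -/
  c_integrable : ∀ t, 0 ≤ t → IntervalIntegrable c volume 0 t
  /-- `τ` is Lebesgue measurable on `[0, ∞)`. -/
  tau_measurable : AEMeasurable τ (volume.restrict (Ici 0))
  tau_le : ∀ t, 0 ≤ t → τ t ≤ t
  tau_tendsto : Tendsto τ atTop atTop

/-- `ρ > inf {t > 0 : tauMin τ t > a}` for some `a ≥ 0` with `tauMin τ a > 0`. -/
def IsAdmissibleStart (τ : ℝ → ℝ) (ρ : ℝ) : Prop :=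
  ∃ a : ℝ, 0 ≤ a ∧ 0 < tauMin τ a ∧ sInf {t : ℝ | 0 < t ∧ a < tauMin τ t} < ρ

/-- `x` is a solution of `x'(t) + c(t) x(τ(t)) = 0` with initial time `t₀`: it is absolutely
continuous on every compact subinterval of `[tauMin τ t₀, ∞)`, and it satisfies the equation
almost everywhere on `[t₀, ∞)`. Only the values of `x` on `[tauMin τ t₀, ∞)` matter. -/
structure IsSolution (c τ : ℝ → ℝ) (t₀ : ℝ) (x : ℝ → ℝ) : Prop where
  absolutelyContinuous :
    ∀ b, tauMin τ t₀ ≤ b → AbsolutelyContinuousOnInterval x (tauMin τ t₀) b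
  equation : ∀ᵐ t ∂volume, t₀ ≤ t → HasDerivAt x (-(c t * x (τ t))) t

/-- From time `t₁` on, the integral of `|c|` over any interval on which `x` has no zero is at
most `ℓ`. -/
def OscillationBoundFrom (c : ℝ → ℝ) (ℓ t₁ : ℝ) (x : ℝ → ℝ) : Prop :=
  ∀ A B : ℝ, t₁ ≤ A → A < B → (∀ v ∈ Ioo A B, x v ≠ 0) → ∫ v in A..B, |c v| ≤ ℓ

/-- `x : [t₀, ∞) → ℝ` is `ℓ`-rapidly oscillating with respect to the coefficient `c`. -/
def IsRapidlyOscillating (c : ℝ → ℝ) (ℓ t₀ : ℝ) (x : ℝ → ℝ) : Prop :=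
  (∀ R : ℝ, ∃ t, R ≤ t ∧ x t = 0) ∧ ∃ t₁, t₀ ≤ t₁ ∧ OscillationBoundFrom c ℓ t₁ x

/-- `Λ(s) = 2 + s - √(2s) - ln(√(2s) - 1)`, used for `s ∈ [1, 2]`. -/
def Lam (s : ℝ) : ℝ := 2 + s - √(2 * s) - Real.log (√(2 * s) - 1)

end

/-! Time is measured by the mass of `|c|`: where the delayed values are at most `K`, the solution is
`K`-Lipschitz in mass. Let `A < B` be zeros with at most `ℓ` mass between them and `|x| ≤ K` on
`[τ_min²(A), B]`. Growth from `A` and decay towards `B` give `|x| ≤ K ℓ / 2` in between, a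
contraction if `ℓ < 2`. Under (b) growth after `A` is slower, because delayed values taken before
`A` are close in mass to the zero `A`; the comparison profile needs mass `Λ(s) - 1` to reach `1`,
and the descent to `B` needs mass `1` more (`exists_contraction_factor`). A maximum argument removes
the assumption on `[A, B]`, so a bound on the history of one zero contracts on the whole half-line
after it (`abs_le_mul_of_window_bound`). The two hypotheses on `τ_min²` force a zero into every
window of a fixed length, and iteration gives exponential decay. -/

/-! ### Increments of solutions measured by the mass of `|c|`. -/

theorem AbsolutelyContinuousOnInterval.comp_lipschitzOnWith {g φ : ℝ → ℝ} {a b : ℝ} {K : NNReal}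
    (hg : AbsolutelyContinuousOnInterval g a b) (hφ : LipschitzOnWith K φ (g '' uIcc a b)) :
    AbsolutelyContinuousOnInterval (fun t => φ (g t)) a b := by
  rw [absolutelyContinuousOnInterval_iff] at hg ⊢
  intro ε hε
  obtain ⟨δ, hδ, h⟩ := hg (ε / (K + 1)) (by positivity)
  refine ⟨δ, hδ, fun E hE hlt => ?_⟩
  have h1 := h E hE hlt
  have hle : ∑ i ∈ Finset.range E.1, dist (φ (g (E.2 i).1)) (φ (g (E.2 i).2)) ≤
      K * ∑ i ∈ Finset.range E.1, dist (g (E.2 i).1) (g (E.2 i).2) := by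
    rw [Finset.mul_sum]
    refine Finset.sum_le_sum fun i hi => ?_
    have hm := hE.1 i hi
    exact hφ.dist_le_mul _ (mem_image_of_mem g hm.1) _ (mem_image_of_mem g hm.2)
  have hs : 0 ≤ ∑ i ∈ Finset.range E.1, dist (g (E.2 i).1) (g (E.2 i).2) :=
    Finset.sum_nonneg fun _ _ => dist_nonneg
  have hK : (K + 1 : ℝ) * ∑ i ∈ Finset.range E.1, dist (g (E.2 i).1) (g (E.2 i).2) < ε := by
    rwa [lt_div_iff₀ (by positivity), mul_comm] at h1
  nlinarith

theorem AbsolutelyContinuousOnInterval.abs_sub_le_of_abs_deriv_le {x H : ℝ → ℝ} {a b : ℝ}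
    (hab : a ≤ b) (hx : AbsolutelyContinuousOnInterval x a b)
    (hH : AbsolutelyContinuousOnInterval H a b)
    (h : ∀ᵐ v, v ∈ Ioc a b → |deriv x v| ≤ deriv H v) :
    |x b - x a| ≤ H b - H a := by
  rw [← hx.integral_deriv_eq_sub, ← hH.integral_deriv_eq_sub]
  exact intervalIntegral.norm_integral_le_of_norm_le (f := deriv x) hab h hH.intervalIntegrable_deriv

theorem intervalIntegrable_abs_of_nonneg {c τ : ℝ → ℝ} (hcτ : IsDelayData c τ) {u w : ℝ}
    (hu : 0 ≤ u) (hw : 0 ≤ w) : IntervalIntegrable (fun v => |c v|) volume u w :=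
  (((hcτ.c_integrable u hu).symm).trans (hcτ.c_integrable w hw)).abs

theorem massFrom_nonneg {c : ℝ → ℝ} {u w : ℝ} (h : u ≤ w) : 0 ≤ ∫ v in u..w, |c v| :=
  intervalIntegral.integral_nonneg h fun _ _ => abs_nonneg _

theorem massFrom_add {c τ : ℝ → ℝ} (hcτ : IsDelayData c τ) {u v w : ℝ}
    (hu : 0 ≤ u) (hv : 0 ≤ v) (hw : 0 ≤ w) :
    (∫ r in u..v, |c r|) + ∫ r in v..w, |c r| = ∫ r in u..w, |c r| :=
  intervalIntegral.integral_add_adjacent_intervals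
    (intervalIntegrable_abs_of_nonneg hcτ hu hv) (intervalIntegrable_abs_of_nonneg hcτ hv hw)

theorem massFrom_absolutelyContinuous {c τ : ℝ → ℝ} (hcτ : IsDelayData c τ) {A u w : ℝ}
    (hA : 0 ≤ A) (hu : 0 ≤ u) (huw : u ≤ w) :
    AbsolutelyContinuousOnInterval (fun t => ∫ r in A..t, |c r|) u w := by
  have h := (intervalIntegrable_abs_of_nonneg hcτ le_rfl
    (hA.trans (le_max_left A w))).absolutelyContinuousOnInterval_intervalIntegral
      (c := A) (by rw [uIcc_of_le (hA.trans (le_max_left A w))]; exact ⟨hA, le_max_left A w⟩)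
  refine h.mono ?_
  rw [uIcc_of_le huw, uIcc_of_le (hA.trans (le_max_left A w))]
  exact Icc_subset_Icc hu (le_max_right A w)

/-- The increment of a solution is dominated by that of `φ` along the accumulated mass of `|c|`,
as soon as the delayed values are dominated by the derivative of `φ`. -/
theorem IsSolution.abs_sub_le {c τ : ℝ → ℝ} (hcτ : IsDelayData c τ) {t₀ : ℝ} {x : ℝ → ℝ}
    (hx : IsSolution c τ t₀ x) (ht₀ : 0 ≤ t₀) (htau : tauMin τ t₀ ≤ t₀) {φ ψ : ℝ → ℝ}
    (hφ : ∀ m, HasDerivAt φ (ψ m) m) (hψ : Continuous ψ) {A u w : ℝ} (hA : 0 ≤ A)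
    (hu : t₀ ≤ u) (huw : u ≤ w)
    (h : ∀ v ∈ Ico u w, |x (τ v)| ≤ ψ (∫ r in A..v, |c r|)) :
    |x w - x u| ≤ φ (∫ r in A..w, |c r|) - φ (∫ r in A..u, |c r|) := by
  have hu0 : 0 ≤ u := ht₀.trans hu
  have hI := massFrom_absolutelyContinuous hcτ hA hu0 huw
  have hC1 : ContDiff ℝ 1 φ := by
    rw [contDiff_one_iff_deriv]
    refine ⟨fun m => (hφ m).differentiableAt, ?_⟩
    rwa [show deriv φ = ψ from funext fun m => (hφ m).deriv]
  have hxac : AbsolutelyContinuousOnInterval x u w := by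
    refine (hx.absolutelyContinuous w (by linarith)).mono ?_
    rw [uIcc_of_le huw, uIcc_of_le (by linarith)]
    exact Icc_subset_Icc (by linarith) le_rfl
  obtain ⟨K, hK⟩ : ∃ K, LipschitzOnWith K φ ((fun t => ∫ r in A..t, |c r|) '' uIcc u w) := by
    obtain ⟨R, hR⟩ := hI.exists_bound
    obtain ⟨K, hK⟩ := (hC1.contDiffOn (s := Icc (-R) R)).exists_lipschitzOnWith (by decide)
      (convex_Icc _ _) isCompact_Icc
    refine ⟨K, hK.mono ?_⟩
    rintro _ ⟨v, hv, rfl⟩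
    exact abs_le.1 (hR v hv)
  refine hxac.abs_sub_le_of_abs_deriv_le huw (hI.comp_lipschitzOnWith hK) ?_
  have hW : 0 ≤ max A w := hA.trans (le_max_left A w)
  have hL := (intervalIntegrable_abs_of_nonneg hcτ le_rfl hW).ae_hasDerivAt_integral
  -- The delayed bound is assumed only before `w`, so that it can be used up to a first failure
  -- time.
  have hne : ∀ᵐ v : ℝ, v ≠ w := by simp [ae_iff]
  filter_upwards [hx.equation, hL, hne] with v hv1 hv2 hv3 hv
  have hv0 : v ∈ uIcc 0 (max A w) := by
    rw [uIcc_of_le hW]; exact ⟨by linarith [hv.1], hv.2.trans (le_max_right A w)⟩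
  have hA0 : A ∈ uIcc 0 (max A w) := by rw [uIcc_of_le hW]; exact ⟨hA, le_max_left A w⟩
  have h2 := (hφ (∫ r in A..v, |c r|)).comp v (hv2 hv0 A hA0)
  have h3 : deriv (fun t => φ (∫ r in A..t, |c r|)) v = ψ (∫ r in A..v, |c r|) * |c v| := h2.deriv
  rw [h3, (hv1 (by linarith [hv.1])).deriv, abs_neg, abs_mul, mul_comm]
  exact mul_le_mul_of_nonneg_right (h v ⟨hv.1.le, lt_of_le_of_ne hv.2 hv3⟩) (abs_nonneg _)

/-! ### The extremal growth profile. -/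

theorem sqrt_two_mul_sub_one_mem {s : ℝ} (hs : s ∈ Icc (1 : ℝ) 2) :
    0 < √(2 * s) - 1 ∧ √(2 * s) - 1 ≤ 1 ∧ (√(2 * s) - 1 + 1) ^ 2 = 2 * s := by
  obtain ⟨h1, h2⟩ := hs
  have hsq := Real.sq_sqrt (show 0 ≤ 2 * s by linarith)
  have h0 := Real.sqrt_nonneg (2 * s)
  refine ⟨by nlinarith, by nlinarith, by linarith⟩

/-- The extremal profile: it starts at `0`, grows at rate at least `min 1 (s - m)` and at least
its own size, and reaches `1` exactly at `Lam s - 1`. -/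
theorem exists_extremal_profile {s : ℝ} (hs : s ∈ Icc (1 : ℝ) 2) :
    ∃ F f : ℝ → ℝ, Continuous f ∧ (∀ m, HasDerivAt F (f m) m) ∧ F 0 = 0 ∧
      (∀ m, 0 ≤ m → F m ≤ f m) ∧ (∀ m, min 1 (s - m) ≤ f m) ∧ (∀ m, 0 < f m) ∧
      F (Lam s - 1) = 1 := by
  obtain ⟨hy0, hy1, hyq⟩ := sqrt_two_mul_sub_one_mem hs
  have hLam : Lam s = 2 + s - (√(2 * s) - 1) - 1 - Real.log (√(2 * s) - 1) := by
    unfold Lam; ring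
  rw [hLam]
  generalize √(2 * s) - 1 = y at *
  obtain ⟨hs1, hs2⟩ := hs
  -- The exponential solves `F' = F` and meets `s - m` at `m = s - y`, with common value `y`.
  set f : ℝ → ℝ := fun m => max (min 1 (s - m)) (y * Real.exp (m - (s - y))) with hf
  have hfc : Continuous f := by fun_prop
  have hfpos : ∀ m, 0 < f m := fun m => lt_max_of_lt_right (by positivity)
  have hii : ∀ a b, IntervalIntegrable f volume a b := fun a b => hfc.intervalIntegrable a b
  have hexp1 : ∀ m, m ≤ s - y → y * Real.exp (m - (s - y)) ≤ y := fun m hm => by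
    have : Real.exp (m - (s - y)) ≤ 1 := Real.exp_le_one_iff.2 (by linarith)
    nlinarith
  have hexp2 : ∀ m, s - y ≤ m → y ≤ y * Real.exp (m - (s - y)) := fun m hm => by
    have : 1 ≤ Real.exp (m - (s - y)) := Real.one_le_exp (by linarith)
    nlinarith
  have hf1 : ∀ m, m ≤ s - 1 → f m = 1 := fun m hm => by
    have := hexp1 m (by linarith)
    simp only [hf]
    rw [min_eq_left (by linarith), max_eq_left (by linarith)]
  have hf2 : ∀ m, s - 1 ≤ m → m ≤ s - y → f m = s - m := fun m hm hm' => by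
    have := hexp1 m hm'
    simp only [hf]
    rw [min_eq_right (by linarith), max_eq_left (by linarith)]
  have hf3 : ∀ m, s - y ≤ m → f m = y * Real.exp (m - (s - y)) := fun m hm => by
    have := hexp2 m hm
    simp only [hf]
    rw [max_eq_right ((min_le_right _ _).trans (by linarith))]
  have hder : ∀ m, HasDerivAt (fun m => ∫ r in (0:ℝ)..m, f r) (f m) m := fun m =>
    intervalIntegral.integral_hasDerivAt_right (hii _ _)
      hfc.stronglyMeasurable.stronglyMeasurableAtFilter hfc.continuousAt
  have hmono : StrictMono (fun m => ∫ r in (0:ℝ)..m, f r) :=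
    strictMono_of_deriv_pos fun m => by rw [(hder m).deriv]; exact hfpos m
  -- The relation `(y + 1)² = 2s` says exactly that `F = f` at the switching point.
  have hFp : ∫ r in (0:ℝ)..(s - y), f r = y := by
    rw [← intervalIntegral.integral_add_adjacent_intervals (hii 0 (s - 1)) (hii (s - 1) (s - y))]
    have e1 : ∫ r in (0:ℝ)..(s - 1), f r = ∫ r in (0:ℝ)..(s - 1), (1:ℝ) :=
      intervalIntegral.integral_congr fun r hr => by
        rw [uIcc_of_le (by linarith)] at hr; exact hf1 r hr.2
    have e2 : ∫ r in (s - 1)..(s - y), f r = ∫ r in (s - 1)..(s - y), (s - r) :=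
      intervalIntegral.integral_congr fun r hr => by
        rw [uIcc_of_le (by linarith)] at hr; exact hf2 r hr.1 hr.2
    rw [e1, e2, intervalIntegral.integral_sub (by simp) (by simp)]
    simp only [intervalIntegral.integral_const, integral_id, smul_eq_mul]
    nlinarith
  have hF3 : ∀ m, s - y ≤ m → ∫ r in (0:ℝ)..m, f r = y * Real.exp (m - (s - y)) := fun m hm => by
    rw [← intervalIntegral.integral_add_adjacent_intervals (hii 0 (s - y)) (hii (s - y) m), hFp]
    have e1 : ∫ r in (s - y)..m, f r = ∫ r in (s - y)..m, y * Real.exp (r - (s - y)) :=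
      intervalIntegral.integral_congr fun r hr => by
        rw [uIcc_of_le hm] at hr; exact hf3 r hr.1
    rw [e1, intervalIntegral.integral_const_mul,
      intervalIntegral.integral_comp_sub_right (fun r => Real.exp r), integral_exp]
    simp only [sub_self, Real.exp_zero]
    ring
  refine ⟨fun m => ∫ r in (0:ℝ)..m, f r, f, hfc, hder, by simp, fun m hm => ?_,
    fun m => le_max_left _ _, hfpos, ?_⟩
  · rcases le_total m (s - y) with h | h
    · have h1 : ∫ r in (0:ℝ)..m, f r ≤ y := hFp ▸ hmono.monotone h
      exact h1.trans (le_max_of_le_left (le_min hy1 (by linarith)))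
    · exact ((hF3 m h).trans (hf3 m h).symm).le
  · have hl : Real.log y ≤ 0 := Real.log_nonpos hy0.le hy1
    show ∫ r in (0:ℝ)..(2 + s - y - 1 - Real.log y - 1), f r = 1
    rw [hF3 _ (by linarith), show 2 + s - y - 1 - Real.log y - 1 - (s - y) = -Real.log y by ring,
      Real.exp_neg, Real.exp_log hy0, mul_inv_cancel₀ hy0.ne']

/-! ### The lower envelope of the delayed argument. -/

theorem tauMin_le_apply {τ : ℝ → ℝ} {a t v : ℝ} (h : 0 < tauMin τ a) (hat : a ≤ t) (htv : t ≤ v) :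
    tauMin τ t ≤ τ v := by
  -- Positivity encodes boundedness below: `sInf` of an unbounded set is `0`.
  have hb : BddBelow (τ '' Ici a) := by
    by_contra hb
    rw [tauMin, Real.sInf_of_not_bddBelow hb] at h
    exact lt_irrefl _ h
  exact csInf_le (hb.mono (image_mono (Ici_subset_Ici.2 hat))) (mem_image_of_mem τ htv)

theorem tauMin_mono {τ : ℝ → ℝ} {a t u : ℝ} (h : 0 < tauMin τ a) (hat : a ≤ t) (htu : t ≤ u) :
    tauMin τ t ≤ tauMin τ u := by
  refine le_csInf (nonempty_Ici.image τ) ?_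
  rintro _ ⟨v, hv, rfl⟩
  exact tauMin_le_apply h hat (htu.trans hv)

theorem IsAdmissibleStart.exists_lt_tauMin {c τ : ℝ → ℝ} (hcτ : IsDelayData c τ) {ρ : ℝ}
    (hρ : IsAdmissibleStart τ ρ) :
    ∃ a, 0 ≤ a ∧ 0 < tauMin τ a ∧ a < ρ ∧ ∀ t, ρ ≤ t → a < tauMin τ t := by
  obtain ⟨a, ha, hpos, hlt⟩ := hρ
  have hne : {t : ℝ | 0 < t ∧ a < tauMin τ t}.Nonempty := by
    obtain ⟨R, hR⟩ := (hcτ.tau_tendsto.eventually_ge_atTop (a + 1)).exists_forall_of_atTop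
    refine ⟨max R 1, lt_max_of_lt_right one_pos, ?_⟩
    refine (lt_add_one a).trans_le (le_csInf (nonempty_Ici.image τ) ?_)
    rintro _ ⟨v, hv, rfl⟩
    exact hR v ((le_max_left _ _).trans hv)
  obtain ⟨t, ⟨ht0, hat⟩, htρ⟩ := exists_lt_of_csInf_lt hne hlt
  have hpos' : 0 < tauMin τ t := ha.trans_lt hat
  have htt : tauMin τ t ≤ t := (tauMin_le_apply hpos' le_rfl le_rfl).trans (hcτ.tau_le t ht0.le)
  exact ⟨a, ha, hpos, by linarith, fun u hu => hat.trans_le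
    (tauMin_mono hpos' le_rfl (htρ.le.trans hu))⟩

theorem tauMin_le_self {c τ : ℝ → ℝ} (hcτ : IsDelayData c τ) {a t : ℝ} (ha : 0 ≤ a)
    (hpos : 0 < tauMin τ a) (hat : a ≤ t) : tauMin τ t ≤ t :=
  (tauMin_le_apply hpos hat le_rfl).trans (hcτ.tau_le t (ha.trans hat))

/-! ### Contraction between zeros. -/

theorem IsSolution.continuousOn {c τ : ℝ → ℝ} {t₀ : ℝ} {x : ℝ → ℝ} (hx : IsSolution c τ t₀ x)
    {u w : ℝ} (hu : tauMin τ t₀ ≤ u) (huw : u ≤ w) : ContinuousOn x (Icc u w) := by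
  refine (hx.absolutelyContinuous w (hu.trans huw)).continuousOn.mono ?_
  rw [uIcc_of_le (hu.trans huw)]
  exact Icc_subset_Icc hu le_rfl

/-- A solution bounded by `K` on `[τ_min²(A), B]` is `K`-Lipschitz with respect to the mass of
`|c|` on `[τ_min(A), B]`. -/
theorem IsSolution.abs_sub_le_mul_mass {c τ : ℝ → ℝ} (hcτ : IsDelayData c τ) {a : ℝ} (ha : 0 ≤ a)
    (hpos : 0 < tauMin τ a) {t₀ : ℝ} {x : ℝ → ℝ} (hx : IsSolution c τ t₀ x) (hat₀ : a ≤ t₀)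
    {A B K u w : ℝ} (haA : a ≤ tauMin τ A) (ht₀ : t₀ ≤ tauMin τ (tauMin τ A))
    (hK : ∀ v ∈ Icc (tauMin τ (tauMin τ A)) B, |x v| ≤ K)
    (hu : tauMin τ A ≤ u) (huw : u ≤ w) (hw : w ≤ B) :
    |x w - x u| ≤ K * ∫ r in u..w, |c r| := by
  have h1 := tauMin_le_self hcτ ha hpos haA
  have h := hx.abs_sub_le hcτ (ha.trans hat₀) (tauMin_le_self hcτ ha hpos hat₀)
    (φ := fun m => K * m) (ψ := fun _ => K)
    (fun m => by simpa using (hasDerivAt_id m).const_mul K) continuous_const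
    (A := u) (u := u) (w := w) (by linarith) (by linarith) huw (fun v hv => hK _ ⟨
      tauMin_le_apply hpos haA (hu.trans hv.1),
      (hcτ.tau_le v (by linarith [hv.1])).trans (hv.2.le.trans hw)⟩)
  simpa using h

/-- Comparison after a zero `A`. If `τ v ≥ A`, the bound already reached gives `K F ≤ K f`. If `τ v
< A`, at most `s - m` of the mass lies between `τ v` and `A`, where `m` is the mass from `A` to `v`,
so the Lipschitz bound gives `K min 1 (s - m) ≤ K f`. -/
theorem abs_le_mul_profile {c τ : ℝ → ℝ} (hcτ : IsDelayData c τ) {a : ℝ} (ha : 0 ≤ a)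
    (hpos : 0 < tauMin τ a) {ρ s : ℝ}
    (hs : ∀ t, ρ ≤ t → ∫ v in (τ t)..t, |c v| ≤ s) {F f : ℝ → ℝ} (hfc : Continuous f)
    (hF : ∀ m, HasDerivAt F (f m) m) (hF0 : F 0 = 0) (hFf : ∀ m, 0 ≤ m → F m ≤ f m)
    (hfs : ∀ m, min 1 (s - m) ≤ f m) (hfpos : ∀ m, 0 < f m)
    {t₀ : ℝ} {x : ℝ → ℝ} (hx : IsSolution c τ t₀ x) (hat₀ : a ≤ t₀)
    {A B K : ℝ} (hρA : ρ ≤ A) (haA' : a ≤ A) (haA : a ≤ tauMin τ A)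
    (ht₀ : t₀ ≤ tauMin τ (tauMin τ A)) (hxA : x A = 0) (hK0 : 0 ≤ K)
    (hK : ∀ v ∈ Icc (tauMin τ (tauMin τ A)) B, |x v| ≤ K) :
    ∀ t ∈ Icc A B, |x t| ≤ K * F (∫ r in A..t, |c r|) := by
  have h1 := tauMin_le_self hcτ ha hpos haA
  have h2 := tauMin_le_self hcτ ha hpos haA'
  have h3 := tauMin_le_self hcτ ha hpos hat₀
  have hA0 : 0 ≤ A := ha.trans haA'
  have hFmono : Monotone F := monotone_of_deriv_nonneg (fun m => (hF m).differentiableAt)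
    fun m => by rw [(hF m).deriv]; exact (hfpos m).le
  have hImono : ∀ {u w}, A ≤ u → u ≤ w → ∫ r in A..u, |c r| ≤ ∫ r in A..w, |c r| := by
    intro u w hu huw
    rw [← massFrom_add hcτ hA0 (hA0.trans hu) (hA0.trans (hu.trans huw))]
    linarith [massFrom_nonneg (c := c) huw]
  -- The perturbation `ε exp` makes the inequality strict, so a first failure time exists; being its
  -- own derivative, it fits the same comparison.
  have key : ∀ ε > 0, ∀ t ∈ Icc A B, |x t| <
      K * F (∫ r in A..t, |c r|) + ε * Real.exp (∫ r in A..t, |c r|) := by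
    intro ε hε
    set φ : ℝ → ℝ := fun m => K * F m + ε * Real.exp m with hφ
    have hφmono : Monotone φ := fun m n hmn => by
      have := hFmono hmn
      have := Real.exp_le_exp.2 hmn
      simp only [hφ]
      gcongr
    by_contra! hbad
    have hcpt : IsCompact {t ∈ Icc A B | φ (∫ r in A..t, |c r|) ≤ |x t|} := by
      refine isCompact_Icc.of_isClosed_subset ?_ (fun t ht => ht.1)
      by_cases hAB : A ≤ B
      · have hI := (massFrom_absolutelyContinuous hcτ hA0 hA0 hAB).continuousOn
        rw [uIcc_of_le hAB] at hI
        have hφc : Continuous φ := by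
          have : Continuous F := continuous_iff_continuousAt.2 fun m => (hF m).continuousAt
          fun_prop
        exact isClosed_Icc.isClosed_le (hφc.comp_continuousOn hI)
          (hx.continuousOn (by linarith) hAB).abs
      · simp [Icc_eq_empty hAB]
    obtain ⟨t, ⟨⟨hAt, htB⟩, hbt⟩, hmin⟩ := hcpt.exists_isLeast hbad
    have hlt : ∀ v, A ≤ v → v < t → |x v| < φ (∫ r in A..v, |c r|) := fun v hv hvt => by
      by_contra! hcon
      exact absurd (hmin ⟨⟨hv, hvt.le.trans htB⟩, hcon⟩) (not_le.2 hvt)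
    have hinc := hx.abs_sub_le hcτ (ha.trans hat₀) h3 (φ := φ)
      (ψ := fun m => K * f m + ε * Real.exp m)
      (fun m => ((hF m).const_mul K).add ((Real.hasDerivAt_exp m).const_mul ε))
      (by fun_prop) (A := A) (u := A) (w := t) hA0 (by linarith) hAt ?_
    · simp only [hxA, intervalIntegral.integral_same, sub_zero] at hinc
      have : φ 0 = ε := by simp [hφ, hF0]
      linarith
    · rintro v ⟨hAv, hvt⟩
      have hτv : τ v ≤ v := hcτ.tau_le v (hA0.trans hAv)
      have hτA : tauMin τ A ≤ τ v := tauMin_le_apply hpos haA' hAv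
      have hτ0 : 0 ≤ τ v := by linarith
      have hexp : 0 < ε * Real.exp (∫ r in A..v, |c r|) := by positivity
      rcases le_total A (τ v) with hle | hle
      · have e1 := hlt (τ v) hle (hτv.trans_lt hvt)
        have e2 := hφmono (hImono hle hτv)
        have e3 := mul_le_mul_of_nonneg_left (hFf _ (massFrom_nonneg (c := c) hAv)) hK0
        simp only [hφ] at e1 e2 ⊢
        linarith
      · have e1 : |x (τ v)| ≤ K := hK _ ⟨by linarith, by linarith⟩
        have e2 := hx.abs_sub_le_mul_mass hcτ ha hpos hat₀ haA ht₀ hK hτA hle (hAt.trans htB)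
        have e3 := massFrom_add hcτ hτ0 hA0 (hA0.trans hAv)
        have e4 := hs v (hρA.trans hAv)
        rw [hxA, zero_sub, abs_neg] at e2
        have e5 : |x (τ v)| ≤ K * min 1 (s - ∫ r in A..v, |c r|) := by
          rcases min_choice 1 (s - ∫ r in A..v, |c r|) with h | h <;> rw [h]
          · linarith
          · exact e2.trans (mul_le_mul_of_nonneg_left (by linarith) hK0)
        have e6 := mul_le_mul_of_nonneg_left (hfs (∫ r in A..v, |c r|)) hK0
        linarith
  intro t ht
  refine le_of_forall_pos_le_add fun ε hε => ?_
  have hE := Real.exp_pos (∫ r in A..t, |c r|)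
  have h := key (ε / Real.exp (∫ r in A..t, |c r|)) (by positivity) t ht
  rw [div_mul_cancel₀ _ hE.ne'] at h
  exact h.le

theorem exists_contraction_factor {c τ : ℝ → ℝ} (hcτ : IsDelayData c τ) {a : ℝ} (ha : 0 ≤ a)
    (hpos : 0 < tauMin τ a) {ρ ℓ : ℝ} (haρ : a < ρ) (hρ : ∀ t, ρ ≤ t → a < tauMin τ t)
    (hstab : ℓ < 2 ∨
      ∃ s ∈ Icc (1 : ℝ) 2, (∀ t, ρ ≤ t → ∫ v in (τ t)..t, |c v| ≤ s) ∧ ℓ < Lam s) :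
    ∃ q : ℝ, 0 < q ∧ q < 1 ∧ ∀ (t₀ : ℝ) (x : ℝ → ℝ) (A B K : ℝ), ρ ≤ t₀ → IsSolution c τ t₀ x →
      ρ ≤ A → t₀ ≤ tauMin τ (tauMin τ A) → x A = 0 → x B = 0 → ∫ v in A..B, |c v| ≤ ℓ →
      0 ≤ K → (∀ v ∈ Icc (tauMin τ (tauMin τ A)) B, |x v| ≤ K) →
      ∀ t ∈ Icc A B, |x t| ≤ q * K := by
  have lin : ∀ (t₀ : ℝ) (x : ℝ → ℝ) (A B K : ℝ), ρ ≤ t₀ → IsSolution c τ t₀ x →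
      ρ ≤ A → t₀ ≤ tauMin τ (tauMin τ A) → x A = 0 → x B = 0 → ∫ v in A..B, |c v| ≤ ℓ →
      0 ≤ K → (∀ v ∈ Icc (tauMin τ (tauMin τ A)) B, |x v| ≤ K) → ∀ t ∈ Icc A B,
      |x t| ≤ K * (∫ v in A..t, |c v|) ∧ |x t| ≤ K * (ℓ - ∫ v in A..t, |c v|) := by
    intro t₀ x A B K ht₀ hx hA hwin hxA hxB hℓ hK0 hK t ⟨hAt, htB⟩
    have haA := (hρ A hA).le
    have haA' : a ≤ A := by linarith
    have hA0 : 0 ≤ A := by linarith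
    have h1 := hx.abs_sub_le_mul_mass hcτ ha hpos (by linarith) haA hwin hK
      (tauMin_le_self hcτ ha hpos haA') hAt htB
    have h2 := hx.abs_sub_le_mul_mass hcτ ha hpos (by linarith) haA hwin hK
      ((tauMin_le_self hcτ ha hpos haA').trans hAt) htB le_rfl
    rw [hxA, sub_zero] at h1
    rw [hxB, zero_sub, abs_neg] at h2
    refine ⟨h1, h2.trans (mul_le_mul_of_nonneg_left ?_ hK0)⟩
    linarith [massFrom_add hcτ hA0 (hA0.trans hAt) (hA0.trans (hAt.trans htB))]
  rcases hstab with hℓ2 | ⟨s, hs, hsup, hΛ⟩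
  -- The bounds from the two zeros average to `K ℓ / 2`; the `1 / 2` keeps `q` positive when `ℓ =
  -- 0`.
  · refine ⟨max (ℓ / 2) (1 / 2), by positivity, max_lt (by linarith) (by norm_num), ?_⟩
    intro t₀ x A B K ht₀ hx hA hwin hxA hxB hℓ hK0 hK t ht
    obtain ⟨h1, h2⟩ := lin t₀ x A B K ht₀ hx hA hwin hxA hxB hℓ hK0 hK t ht
    have := mul_le_mul_of_nonneg_right (le_max_left (ℓ / 2) (1 / 2)) hK0
    linarith
  · obtain ⟨F, f, hfc, hF, hF0, hFf, hfs, hfpos, hF1⟩ := exists_extremal_profile hs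
    have hFmono : StrictMono F := strictMono_of_deriv_pos fun m => by
      rw [(hF m).deriv]; exact hfpos m
    -- Half the slack goes to each side: up to mass `Lam s - 1 - h` the profile stays below `1`, and
    -- beyond it at most `1 - h` is left before `B`.
    set h := (Lam s - ℓ) / 2 with hh
    have hh0 : 0 < h := by simp only [hh]; linarith
    have hq : F (Lam s - 1 - h) < 1 := hF1 ▸ hFmono (by linarith)
    refine ⟨max (max (F (Lam s - 1 - h)) (1 - h)) (1 / 2), lt_max_of_lt_right (by norm_num),
      max_lt (max_lt hq (by linarith)) (by norm_num), ?_⟩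
    intro t₀ x A B K ht₀ hx hA hwin hxA hxB hℓ hK0 hK t ht
    obtain ⟨-, h2⟩ := lin t₀ x A B K ht₀ hx hA hwin hxA hxB hℓ hK0 hK t ht
    have h3 := abs_le_mul_profile hcτ ha hpos hsup hfc hF hF0 hFf hfs hfpos hx (by linarith) hA
      (by linarith) (hρ A hA).le hwin hxA hK0 hK t ht
    rw [mul_comm _ K]
    rcases le_total (∫ v in A..t, |c v|) (Lam s - 1 - h) with hI | hI
    · exact h3.trans (mul_le_mul_of_nonneg_left ((hFmono.monotone hI).trans
        ((le_max_left _ _).trans (le_max_left _ _))) hK0)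
    · refine h2.trans (mul_le_mul_of_nonneg_left (le_trans ?_
        ((le_max_right _ _).trans (le_max_left _ _))) hK0)
      simp only [hh] at hI ⊢
      linarith

/-! ### Propagation beyond a zero. -/

/-- A point where `x` does not vanish lies between two consecutive zeros. -/
theorem exists_adjacent_zeros {x : ℝ → ℝ} {A B t : ℝ} (hx : ContinuousOn x (Icc A B))
    (hA : x A = 0) (hB : x B = 0) (ht : t ∈ Icc A B) (hxt : x t ≠ 0) :
    ∃ A' B', A ≤ A' ∧ A' < t ∧ t < B' ∧ B' ≤ B ∧ x A' = 0 ∧ x B' = 0 ∧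
      ∀ v ∈ Ioo A' B', x v ≠ 0 := by
  have hc : ∀ {u w}, A ≤ u → w ≤ B → IsCompact {v ∈ Icc u w | x v = 0} := by
    intro u w hu hw
    exact isCompact_Icc.of_isClosed_subset
      ((hx.mono (Icc_subset_Icc hu hw)).preimage_isClosed_of_isClosed isClosed_Icc
        isClosed_singleton) (fun v hv => hv.1)
  obtain ⟨A', ⟨hA', hxA'⟩, hmax⟩ := (hc (u := A) (w := t) le_rfl ht.2).exists_isGreatest
    ⟨A, ⟨le_rfl, ht.1⟩, hA⟩
  obtain ⟨B', ⟨hB', hxB'⟩, hmin⟩ := (hc (u := t) (w := B) ht.1 le_rfl).exists_isLeast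
    ⟨B, ⟨ht.2, le_rfl⟩, hB⟩
  have hAt : A' < t := lt_of_le_of_ne hA'.2 (by rintro rfl; exact hxt hxA')
  have htB : t < B' := lt_of_le_of_ne hB'.1 (by rintro rfl; exact hxt hxB')
  refine ⟨A', B', hA'.1, hAt, htB, hB'.2, hxA', hxB', fun v hv hv0 => ?_⟩
  rcases le_total v t with h | h
  · exact absurd (hmax ⟨⟨hA'.1.trans hv.1.le, h⟩, hv0⟩) (not_le.2 hv.1)
  · exact absurd (hmin ⟨⟨h, hv.2.le.trans hB'.2⟩, hv0⟩) (not_le.2 hv.2)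

/-- A bound on the history window of a zero `A` propagates, with the contraction factor, to the
whole half-line `[A, ∞)`. -/
theorem abs_le_mul_of_window_bound {c τ : ℝ → ℝ} (hcτ : IsDelayData c τ) {a : ℝ} (ha : 0 ≤ a)
    (hpos : 0 < tauMin τ a) {ρ ℓ q : ℝ} (haρ : a < ρ) (hρ : ∀ t, ρ ≤ t → a < tauMin τ t)
    (hq0 : 0 < q) (hq1 : q < 1)
    (hq : ∀ (t₀ : ℝ) (x : ℝ → ℝ) (A B K : ℝ), ρ ≤ t₀ → IsSolution c τ t₀ x →
      ρ ≤ A → t₀ ≤ tauMin τ (tauMin τ A) → x A = 0 → x B = 0 → ∫ v in A..B, |c v| ≤ ℓ →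
      0 ≤ K → (∀ v ∈ Icc (tauMin τ (tauMin τ A)) B, |x v| ≤ K) →
      ∀ t ∈ Icc A B, |x t| ≤ q * K)
    {t₀ t₁ : ℝ} {x : ℝ → ℝ} (ht₀ : ρ ≤ t₀) (hx : IsSolution c τ t₀ x)
    (hosc : ∀ R : ℝ, ∃ t, R ≤ t ∧ x t = 0) (ht₁ : t₀ ≤ t₁) (hbd : OscillationBoundFrom c ℓ t₁ x)
    {A K : ℝ} (hA : ρ ≤ A) (hwin : t₁ ≤ tauMin τ (tauMin τ A)) (hxA : x A = 0)
    (hK : ∀ v ∈ Icc (tauMin τ (tauMin τ A)) A, |x v| ≤ K) :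
    ∀ t, A ≤ t → |x t| ≤ q * K := by
  have hWA : tauMin τ (tauMin τ A) ≤ A := (tauMin_le_self hcτ ha hpos (hρ A hA).le).trans
    (tauMin_le_self hcτ ha hpos (by linarith))
  have hK0 : 0 ≤ K := (abs_nonneg _).trans (hK A ⟨hWA, le_rfl⟩)
  have hst : tauMin τ t₀ ≤ t₀ := tauMin_le_self hcτ ha hpos (by linarith)
  have main : ∀ L, 0 ≤ L → ∀ B, x B = 0 → (∀ v ∈ Icc (tauMin τ (tauMin τ A)) B, |x v| ≤ L) →
      ∀ t ∈ Icc A B, |x t| ≤ q * L := by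
    intro L hL B hxB hLB t ht
    rcases eq_or_ne (x t) 0 with h0 | h0
    · rw [h0, abs_zero]; positivity
    obtain ⟨A', B', hAA', hA't, htB', hB'B, hxA', hxB', hne⟩ := exists_adjacent_zeros
      (hx.continuousOn (by linarith) (ht.1.trans ht.2)) hxA hxB ht h0
    have hWW : tauMin τ (tauMin τ A) ≤ tauMin τ (tauMin τ A') :=
      tauMin_mono hpos (hρ A hA).le (tauMin_mono hpos (by linarith) hAA')
    exact hq t₀ x A' B' L ht₀ hx (hA.trans hAA') (by linarith) hxA' hxB'
      (hbd A' B' (by linarith) (hA't.trans htB') hne) hL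
      (fun v hv => hLB v ⟨hWW.trans hv.1, hv.2.trans hB'B⟩) t ⟨hA't.le, htB'.le⟩
  -- A maximum exceeding `K` would lie after `A`, and contraction with `L = |x t|` would give `|x t|
  -- ≤ q |x t|`.
  have hKB : ∀ B, A ≤ B → x B = 0 → ∀ v ∈ Icc (tauMin τ (tauMin τ A)) B, |x v| ≤ K := by
    intro B hAB hxB v hv
    obtain ⟨t, ht, hmax⟩ := isCompact_Icc.exists_isMaxOn ⟨v, hv⟩
      (hx.continuousOn (u := tauMin τ (tauMin τ A)) (w := B) (by linarith) (by linarith)).abs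
    refine (hmax hv).trans ?_
    by_contra! hlt
    have hAt : A < t := by
      by_contra! h
      exact absurd (hK t ⟨ht.1, h⟩) (not_le.2 hlt)
    have h := main |x t| (abs_nonneg _) B hxB (fun u hu => hmax hu) t ⟨hAt.le, ht.2⟩
    nlinarith [abs_nonneg (x t)]
  intro t ht
  obtain ⟨B, htB, hxB⟩ := hosc t
  exact main K hK0 B hxB (hKB B (ht.trans htB) hxB) t ⟨ht, htB⟩

/-! ### Recurrence of zeros and exponential decay. -/

theorem mul_le_mass_of_window_mass {c τ : ℝ → ℝ} (hcτ : IsDelayData c τ) {C D T : ℝ}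
    (hT0 : 0 ≤ T) (hC : 0 ≤ C) (h : ∀ S, T ≤ S → D ≤ ∫ v in S..(S + C), |c v|) (n : ℕ) :
    ∀ S, T ≤ S → n * D ≤ ∫ v in S..(S + n * C), |c v| := by
  induction n with
  | zero => intro S _; simp
  | succ n ih =>
    intro S hS
    have hn : 0 ≤ n * C := by positivity
    have h1 := ih S hS
    have h2 := h (S + n * C) (by linarith)
    rw [← massFrom_add hcτ (v := S + n * C) (by linarith) (by linarith)
      (by push_cast; nlinarith)]
    have e : S + ((n + 1 : ℕ) : ℝ) * C = S + n * C + C := by push_cast; ring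
    rw [e]
    push_cast
    linarith

theorem abs_le_exp_decay_of_step {x : ℝ → ℝ} {q δ K t₁ : ℝ} (hq0 : 0 < q) (hq1 : q < 1)
    (hδ : 0 < δ) (hK : 0 ≤ K) (h0 : ∀ t, t₁ ≤ t → |x t| ≤ K)
    (hstep : ∀ S L, t₁ ≤ S → (∀ t, S ≤ t → |x t| ≤ L) → ∀ t, S + δ ≤ t → |x t| ≤ q * L)
    {t : ℝ} (ht : t₁ ≤ t) :
    |x t| ≤ q⁻¹ * K * Real.exp (-(-Real.log q / δ) * (t - t₁)) := by
  have hpow : ∀ n : ℕ, ∀ t, t₁ + n * δ ≤ t → |x t| ≤ q ^ n * K := by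
    intro n
    induction n with
    | zero => intro t ht; simpa using h0 t (by simpa using ht)
    | succ n ih =>
      intro t ht
      have hn : 0 ≤ n * δ := by positivity
      have := hstep (t₁ + n * δ) (q ^ n * K) (by linarith) ih t (by push_cast at ht; linarith)
      rw [pow_succ]
      linarith
  have hr : 0 ≤ (t - t₁) / δ := div_nonneg (by linarith) hδ.le
  have hfl := Nat.floor_le hr
  have hlt := Nat.lt_floor_add_one ((t - t₁) / δ)
  have h1 := hpow ⌊(t - t₁) / δ⌋₊ t (by rw [le_div_iff₀ hδ] at hfl; linarith)
  refine h1.trans ?_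
  have hlog : Real.log q < 0 := Real.log_neg hq0 hq1
  -- Rounding down to whole steps costs at most one factor `q⁻¹`.
  have h2 : q ^ ⌊(t - t₁) / δ⌋₊ ≤ q⁻¹ * Real.exp (-(-Real.log q / δ) * (t - t₁)) := by
    rw [← Real.rpow_natCast, Real.rpow_def_of_pos hq0, ← Real.exp_log (inv_pos.2 hq0), Real.log_inv,
      ← Real.exp_add]
    refine Real.exp_le_exp.2 ?_
    have e : -Real.log q + -(-Real.log q / δ) * (t - t₁) = Real.log q * ((t - t₁) / δ - 1) := by
      ring
    rw [e]
    exact mul_le_mul_of_nonpos_left (by linarith) hlog.le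
  calc q ^ ⌊(t - t₁) / δ⌋₊ * K ≤ q⁻¹ * Real.exp (-(-Real.log q / δ) * (t - t₁)) * K :=
        mul_le_mul_of_nonneg_right h2 hK
    _ = _ := by ring

theorem theorem19p14 (c τ : ℝ → ℝ) (hcτ : IsDelayData c τ)
    (ρ : ℝ) (hρ : IsAdmissibleStart τ ρ)
    (ℓ : ℝ) (hℓ : 0 ≤ ℓ)
    (hstab : ℓ < 2 ∨
      ∃ s ∈ Icc (1 : ℝ) 2, (∀ t, ρ ≤ t → ∫ v in (τ t)..t, |c v| ≤ s) ∧ ℓ < Lam s)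
    (C D T : ℝ) (hC : 0 < C) (hD : 0 < D) (hT : ρ ≤ T)
    (hdelay : ∀ t, T ≤ t → |t - tauMin τ (tauMin τ t)| ≤ C)
    (hmass : ∀ t, T ≤ t → D ≤ ∫ v in (tauMin τ (tauMin τ t))..t, |c v|) :
    ∃ M γ δ : ℝ, 0 < M ∧ 0 < γ ∧ 0 < δ ∧
      ∀ (t₀ : ℝ) (x : ℝ → ℝ), ρ ≤ t₀ → IsSolution c τ t₀ x → IsRapidlyOscillating c ℓ t₀ x →
        ∀ t₁ : ℝ, t₀ ≤ t₁ → T ≤ t₁ → OscillationBoundFrom c ℓ t₁ x →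
          ∀ t, t₁ ≤ t →
            |x t| ≤ M * sSup ((fun u => |x u|) '' Icc t₁ (t₁ + δ)) *
              Real.exp (-γ * (t - t₁)) := by

  obtain ⟨a, ha, hpos, haρ, hρa⟩ := hρ.exists_lt_tauMin hcτ
  obtain ⟨q, hq0, hq1, hq⟩ := exists_contraction_factor hcτ ha hpos haρ hρa hstab
  have hW : ∀ t, ρ ≤ t → tauMin τ (tauMin τ t) ≤ t := fun t ht =>
    (tauMin_le_self hcτ ha hpos (hρa t ht).le).trans (tauMin_le_self hcτ ha hpos (by linarith))
  have hWC : ∀ t, T ≤ t → t - C ≤ tauMin τ (tauMin τ t) := fun t ht => by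
    linarith [(abs_le.1 (hdelay t ht)).2]
  have hmassC : ∀ S, T ≤ S → D ≤ ∫ v in S..(S + C), |c v| := by
    intro S hS
    have h1 := hmass (S + C) (by linarith)
    have h2 := hWC (S + C) (by linarith)
    have h3 := hW (S + C) (by linarith)
    have h4 := massFrom_add hcτ (u := S) (v := tauMin τ (tauMin τ (S + C))) (w := S + C)
      (by linarith) (by linarith) (by linarith)
    have h5 := massFrom_nonneg (c := c) (u := S) (w := tauMin τ (tauMin τ (S + C))) (by linarith)
    linarith
  -- A length `n C` carries mass `n D > ℓ`, too much for an interval without zeros.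
  obtain ⟨n, hn⟩ := exists_nat_gt (ℓ / D)
  have hn' : ℓ < n * D := (div_lt_iff₀ hD).1 hn
  have hn0 : 0 < (n : ℝ) := (div_nonneg hℓ hD.le).trans_lt hn
  have hnC : 0 < n * C := mul_pos hn0 hC
  refine ⟨q⁻¹, -Real.log q / (C + n * C), C + n * C, inv_pos.2 hq0,
    div_pos (neg_pos.2 (Real.log_neg hq0 hq1)) (by linarith), by linarith, ?_⟩
  intro t₀ x ht₀ hx hosc t₁ ht₁ hTt₁ hbd t ht
  -- The initial gap `C` keeps the history window `[τ_min²(z), z]` of the zero inside `[S, z]`.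
  have hzero : ∀ S, t₁ ≤ S → ∃ z, S + C ≤ z ∧ z ≤ S + (C + n * C) ∧ x z = 0 := by
    intro S hS
    by_contra! hne
    have h1 := hbd (S + C) (S + C + n * C) (by linarith) (by linarith)
      (fun v hv => hne v hv.1.le (by linarith [hv.2]))
    have h2 := mul_le_mass_of_window_mass hcτ (by linarith) hC.le hmassC n (S + C) (by linarith)
    linarith
  have hprop : ∀ S L, t₁ ≤ S → (∀ u ∈ Icc S (S + (C + n * C)), |x u| ≤ L) →
      ∃ z, z ∈ Icc S (S + (C + n * C)) ∧ ∀ u, z ≤ u → |x u| ≤ q * L := by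
    intro S L hS hL
    obtain ⟨z, hz1, hz2, hxz⟩ := hzero S hS
    have hz3 := hWC z (by linarith)
    refine ⟨z, ⟨by linarith, hz2⟩, abs_le_mul_of_window_bound hcτ ha hpos haρ hρa hq0 hq1 hq ht₀ hx
      hosc.1 ht₁ hbd (by linarith) (by linarith) hxz ?_⟩
    exact fun v hv => hL v ⟨by linarith [hv.1], hv.2.trans hz2⟩
  have hst : tauMin τ t₀ ≤ t₀ := tauMin_le_self hcτ ha hpos (by linarith)
  have hbdd : BddAbove ((fun u => |x u|) '' Icc t₁ (t₁ + (C + n * C))) :=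
    isCompact_Icc.bddAbove_image (hx.continuousOn (by linarith) (by linarith)).abs
  have hsup : ∀ u ∈ Icc t₁ (t₁ + (C + n * C)),
      |x u| ≤ sSup ((fun u => |x u|) '' Icc t₁ (t₁ + (C + n * C))) := fun u hu =>
    le_csSup hbdd (mem_image_of_mem (fun u => |x u|) hu)
  have hsup0 := (abs_nonneg (x t₁)).trans (hsup t₁ ⟨le_rfl, by linarith⟩)
  refine abs_le_exp_decay_of_step hq0 hq1 (by linarith) hsup0 ?_ ?_ ht
  · intro u hu
    obtain ⟨z, hz, hzq⟩ := hprop t₁ _ le_rfl hsup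
    rcases le_total u z with h | h
    · exact hsup u ⟨hu, h.trans hz.2⟩
    · exact (hzq u h).trans (mul_le_of_le_one_left hsup0 hq1.le)
  · intro S L hS hL u hu
    obtain ⟨z, hz, hzq⟩ := hprop S L hS (fun v hv => hL v hv.1)
    exact hzq u (hz.2.trans hu)
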